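/- Let $p_1,p_2,m,\delta$ be natural numbers with $p_1,p_2,m\ge 1$. A \emph{uniformly random $\delta$-left regular bipartite graph} with left set $[p_1]$ and right set $[m]$ is obtained by choosing, for every $i\in[p_1]$, right vertices $e_{i,1},\dots,e_{i,\delta}$ uniformly from $[m]$, all choices being independent (so with replacement), and joining $i$ to each of them. Its adjacency matrix $A\in\mathbb{R}^{m\times p_1}$ may be taken with multiplicities, $A_{ji}=|\{k: e_{i,k}=j\}|$, or as the $0$-$1$ matrix with $A_{ji}=1$ if and only if $e_{i,k}=j$ for some $k$; the result below holds for both conventions. Let $B\in\mathbb{R}^{m\times p_2}$ be the adjacency matrix, in the same convention, of an independent uniformly random $\delta$-left regular bipartite graph with left set $[p_2]$ and right set $[m]$. For a matrix $Z$ write $\|Z\|_1=\sum_{i,j}|Z_{ij}|$, and for $X\in\mathbb{R}^{p_1\times p_2}$ consider the program $$\text{(P}_1)\qquad \min_{\tilde X\in\mathbb{R}^{p_1\times p_2}}\ \|\tilde X\|_1\quad\text{subject to}\quad A\tilde XB^T=Y,\qquad Y:=AXB^T .$$ \textbf{Corollary.} For all constants $0<a\le b$ there are constants $C>0$ and $c>0$,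 depending only on $a$ and $b$, such that the following holds. Let $X\in\mathbb{R}^{p_1\times p_2}$ be a fixed matrix in which every row has at most $d_r$ and every column has at most $d_c$ non-zero entries, and put $p=\max(p_1,p_2)$ and $d=\max(d_r,d_c)$. If $p\ge 2$, $$a\log p\le\delta\le b\log p\qquad\text{and}\qquad m\ge C\sqrt{dp}\,\log p ,$$ then, with probability exceeding $1-p^{-c}$ over the choice of the two graphs, $X$ is the unique optimal solution of (P$_1$). -/

import Mathlib

open MeasureTheory ProbabilityTheory

noncomputable section

/-- The entrywise `ℓ₁` norm of a matrix, that is, the `ℓ₁` norm of its vectorization. -/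
def entryL1 {p₁ p₂ : ℕ} (X : Matrix (Fin p₁) (Fin p₂) ℝ) : ℝ :=
  ∑ i, ∑ j, |X i j|

/-- No row of `X` has more than `d` non-zero entries. -/
def RowDegreeLE {p₁ p₂ : ℕ} (X : Matrix (Fin p₁) (Fin p₂) ℝ) (d : ℕ) : Prop :=
  ∀ i, {j | X i j ≠ 0}.ncard ≤ d

/-- No column of `X` has more than `d` non-zero entries. -/
def ColDegreeLE {p₁ p₂ : ℕ} (X : Matrix (Fin p₁) (Fin p₂) ℝ) (d : ℕ) : Prop :=
  ∀ j, {i | X i j ≠ 0}.ncard ≤ d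

/-- `Z` is an optimal solution of the program: minimize `‖X'‖₁` subject to `A X' Bᵀ = Y`. -/
def IsL1Solution {m p₁ p₂ : ℕ} (A : Matrix (Fin m) (Fin p₁) ℝ) (B : Matrix (Fin m) (Fin p₂) ℝ)
    (Y : Matrix (Fin m) (Fin m) ℝ) (Z : Matrix (Fin p₁) (Fin p₂) ℝ) : Prop :=
  A * Z * B.transpose = Y ∧
    ∀ X' : Matrix (Fin p₁) (Fin p₂) ℝ, A * X' * B.transpose = Y → entryL1 Z ≤ entryL1 X'

/-- Exact recovery: the program with data `Y = A X Bᵀ` has `X` as its unique optimal solution. -/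
def L1Recovers {m p₁ p₂ : ℕ} (A : Matrix (Fin m) (Fin p₁) ℝ) (B : Matrix (Fin m) (Fin p₂) ℝ)
    (X : Matrix (Fin p₁) (Fin p₂) ℝ) : Prop :=
  ∀ Z : Matrix (Fin p₁) (Fin p₂) ℝ, IsL1Solution A B (A * X * B.transpose) Z ↔ Z = X

/-- A bipartite multigraph with left set `[p]` and right set `[m]` in which every left vertex `i`
emits `δ` numbered edges: `e i k` is the right end of the `k`-th edge at `i`. -/
abbrev LeftRegularGraph (p m δ : ℕ) : Type := Fin p → Fin δ → Fin m

/-- The law of the uniformly random `δ`-left regular bipartite graph: all the right ends `e i k` are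
independent and uniform on `[m]` (sampling with replacement). -/
def randomLeftRegular (p m δ : ℕ) : Measure (LeftRegularGraph p m δ) :=
  Measure.pi fun _ => Measure.pi fun _ => uniformOn (Set.univ : Set (Fin m))

/-- The adjacency matrix with multiplicities: the entry at `(j, i)` is the number of edges between
`i` and `j`, so that each column sums to `δ`. -/
def multAdj {p m δ : ℕ} (e : LeftRegularGraph p m δ) : Matrix (Fin m) (Fin p) ℝ :=
  Matrix.of fun j i => ((Finset.univ.filter fun k => e i k = j).card : ℝ)

open Classical in
/-- The `0`-`1` adjacency matrix: the entry at `(j, i)` is `1` if `i` and `j` are joined by an edge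
and `0` otherwise. -/
def zeroOneAdj {p m δ : ℕ} (e : LeftRegularGraph p m δ) : Matrix (Fin m) (Fin p) ℝ :=
  Matrix.of fun j i => if ∃ k, e i k = j then 1 else 0

end

/-! View A X Bᵀ as the Kronecker product of A and B applied to the vector X. A position w = (i, i')
then emits δ² edge pairs into the m² cells. Let Ω be the support of X. A kernel vector V has signed
sum zero in every cell. In a cell met by a single position of Ω, the mass there is therefore bounded
by the mass arriving from outside Ω. Suppose each position of Ω keeps more than β = δ²/8 of its
weight in such private cells, and each position outside sends at most β into cells met by Ω. Then V
has less mass on Ω than off it, so ‖X + V‖₁ > ‖X‖₁ (`sum_abs_lt_sum_abs_compl`,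
`l1Recovers_of_weights`).

Both conditions follow when every w has fewer than δ²/8 collisions with other positions of Ω and,
for the 0-1 convention, every vertex has more than δ/2 distinct ends. Since Ω is fixed, a union
bound over positions and vertices suffices, not one over supports. Given all other vertices, the
collisions at w are hits of a fixed sparse cell set W by a δ × δ grid with random coordinates
(`exists_collisionCount_le`). Grid points are dependent, but each cyclic diagonal consists of δ
independent cells, so the exponential Markov inequality on each diagonal bounds the failure
probability by (4/y)^δ whenever |W| y⁸ ≤ m² (`card_many_hits_mul_pow_le`). With y = 4 exp(5/a) this
is at most p⁻⁵, which beats the fewer than p⁴ events. -/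

/-! ### Null space property and recovery -/

open Classical in
/-- A null space property: if every index in `Ω` sends more than `β` of its weight to rows that meet
no other index of `Ω`, and every index outside `Ω` sends at most `β` to rows that meet `Ω`, then
kernel vectors have less mass on `Ω` than off it. -/
theorem sum_abs_lt_sum_abs_compl {ι ρ : Type*} [Fintype ι] [DecidableEq ι] [Fintype ρ]
    (M : ρ → ι → ℝ) (hM : ∀ r i, 0 ≤ M r i) (Ω : Finset ι) (β : ℝ) (v : ι → ℝ) (hv : ∀ r, ∑ i, M r i * v i = 0)
    (hin : ∀ i ∈ Ω, β < ∑ r, if ∃ j ∈ Ω, j ≠ i ∧ M r j ≠ 0 then 0 else M r i)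
    (hout : ∀ i ∉ Ω, (∑ r, if ∃ j ∈ Ω, j ≠ i ∧ M r j ≠ 0 then M r i else 0) ≤ β)
    (hβ : 0 ≤ β) (hv0 : v ≠ 0) :
    ∑ i ∈ Ω, |v i| < ∑ i ∈ Ωᶜ, |v i| := by
  have hrow : ∀ r, ∑ i ∈ Ω, (if ∃ j ∈ Ω, j ≠ i ∧ M r j ≠ 0 then 0 else M r i) * |v i| ≤
      ∑ i ∈ Ωᶜ, (if ∃ j ∈ Ω, j ≠ i ∧ M r j ≠ 0 then M r i else 0) * |v i| := by
    intro r
    -- Either exactly one index of Ω meets the row `r`, and the kernel equation bounds its mass, or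
    -- the left side vanishes.
    by_cases h : ∃ i ∈ Ω, M r i ≠ 0 ∧ ¬ ∃ j ∈ Ω, j ≠ i ∧ M r j ≠ 0
    · obtain ⟨i, hi, hri, hcov⟩ := h
      have hz : ∀ j ∈ Ω, j ≠ i → M r j = 0 := by
        intro j hj hji
        by_contra hne
        exact hcov ⟨j, hj, hji, hne⟩
      rw [Finset.sum_eq_single_of_mem i hi, if_neg hcov]
      · have hsplit := hv r
        rw [← Finset.sum_add_sum_compl Ω, Finset.sum_eq_single_of_mem i hi] at hsplit
        · have : M r i * |v i| = |∑ j ∈ Ωᶜ, M r j * v j| := by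
            rw [← congrArg (· * |v i|) (abs_of_nonneg (hM r i)), ← abs_mul,
              eq_neg_of_add_eq_zero_left hsplit, abs_neg]
          rw [this]
          refine (Finset.abs_sum_le_sum_abs _ _).trans (Finset.sum_le_sum fun j hj => ?_)
          have hj' : j ∉ Ω := by simpa using hj
          rw [if_pos ⟨i, hi, fun h => hj' (h ▸ hi), hri⟩, abs_mul, abs_of_nonneg (hM r j)]
        · intro j hj hji
          rw [hz j hj hji, zero_mul]
      · intro j hj hji
        rw [hz j hj hji]
        simp
    · push Not at h
      rw [Finset.sum_eq_zero]
      · refine Finset.sum_nonneg fun j _ => mul_nonneg ?_ (abs_nonneg _)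
        split_ifs
        · exact hM r j
        · exact le_rfl
      · intro i hi
        by_cases h0 : M r i = 0
        · simp [h0]
        · rw [if_pos (h i hi h0), zero_mul]
  have hsum := Finset.sum_le_sum fun r (_ : r ∈ Finset.univ) => hrow r
  rw [Finset.sum_comm, Finset.sum_comm (s := Finset.univ) (t := Ωᶜ)] at hsum
  simp_rw [← Finset.sum_mul] at hsum
  have hout' : ∑ i ∈ Ωᶜ, (∑ r, if ∃ j ∈ Ω, j ≠ i ∧ M r j ≠ 0 then M r i else 0) * |v i| ≤
      β * ∑ i ∈ Ωᶜ, |v i| := by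
    rw [Finset.mul_sum]
    exact Finset.sum_le_sum fun i hi =>
      mul_le_mul_of_nonneg_right (hout i (by simpa using hi)) (abs_nonneg _)
  -- The strict inequality in `hin` only helps at a nonzero entry of `v` on Ω; if there is none, all
  -- mass of `v` lies off Ω.
  by_cases hΩ : ∀ i ∈ Ω, v i = 0
  · rw [Finset.sum_eq_zero fun i hi => by rw [hΩ i hi, abs_zero]]
    obtain ⟨i, hi⟩ := Function.ne_iff.mp hv0
    exact Finset.sum_pos' (fun _ _ => abs_nonneg _)
      ⟨i, by simpa using fun h => hi (hΩ i h), abs_pos.mpr hi⟩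
  · push Not at hΩ
    obtain ⟨i, hi, hvi⟩ := hΩ
    have hlt : β * ∑ i ∈ Ω, |v i| <
        ∑ i ∈ Ω, (∑ r, if ∃ j ∈ Ω, j ≠ i ∧ M r j ≠ 0 then 0 else M r i) * |v i| := by
      rw [Finset.mul_sum]
      exact Finset.sum_lt_sum
        (fun j hj => mul_le_mul_of_nonneg_right (hin j hj).le (abs_nonneg _))
        ⟨i, hi, mul_lt_mul_of_pos_right (hin i hi) (abs_pos.mpr hvi)⟩
    exact lt_of_mul_lt_mul_left (hlt.trans_le (hsum.trans hout')) hβ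

/-- Recovery holds if moving along the kernel strictly increases the norm. -/
theorem l1Recovers_of_forall_ker {m p₁ p₂ : ℕ} {A : Matrix (Fin m) (Fin p₁) ℝ}
    {B : Matrix (Fin m) (Fin p₂) ℝ} {X : Matrix (Fin p₁) (Fin p₂) ℝ}
    (h : ∀ V, A * V * B.transpose = 0 → V ≠ 0 → entryL1 X < entryL1 (X + V)) :
    L1Recovers A B X := by
  have key : ∀ Z, A * Z * B.transpose = A * X * B.transpose → Z ≠ X →
      entryL1 X < entryL1 Z := by
    intro Z hZ hne
    have := h (Z - X) (by rw [Matrix.mul_sub, Matrix.sub_mul, hZ, sub_self]) (sub_ne_zero.mpr hne)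
    rwa [add_sub_cancel] at this
  intro Z
  constructor
  · rintro ⟨hZ, hmin⟩
    by_contra hne
    exact absurd (hmin X rfl) (not_le.mpr (key Z hZ hne))
  · rintro rfl
    refine ⟨rfl, fun X' hX' => ?_⟩
    rcases eq_or_ne X' Z with rfl | hne
    · exact le_rfl
    · exact (key X' hX' hne).le

/-- Serves the degenerate case d = 0, where the sampling condition says nothing about m. -/
theorem l1Recovers_zero {m p₁ p₂ : ℕ} (A : Matrix (Fin m) (Fin p₁) ℝ)
    (B : Matrix (Fin m) (Fin p₂) ℝ) : L1Recovers A B 0 := by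
  refine l1Recovers_of_forall_ker fun V _ hV => ?_
  have : ∃ i j, V i j ≠ 0 := by
    by_contra! h
    exact hV (Matrix.ext h)
  obtain ⟨i, j, hij⟩ := this
  simp only [entryL1, Matrix.zero_apply, abs_zero, Finset.sum_const_zero, zero_add]
  exact Finset.sum_pos' (fun _ _ => Finset.sum_nonneg fun _ _ => abs_nonneg _)
    ⟨i, Finset.mem_univ _, Finset.sum_pos' (fun _ _ => abs_nonneg _)
      ⟨j, Finset.mem_univ _, abs_pos.mpr hij⟩⟩

-- The null space property applies to the Kronecker product, with rows indexed by pairs of right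
-- vertices. The triangle inequality on the support of X turns the resulting mass comparison into a
-- strict increase of the norm.
open Classical in
theorem l1Recovers_of_weights {m p₁ p₂ : ℕ} {A : Matrix (Fin m) (Fin p₁) ℝ}
    {B : Matrix (Fin m) (Fin p₂) ℝ} (hA : ∀ r i, 0 ≤ A r i) (hB : ∀ r i, 0 ≤ B r i)
    (X : Matrix (Fin p₁) (Fin p₂) ℝ) (β : ℝ) (hβ : 0 ≤ β)
    (hin : ∀ w : Fin p₁ × Fin p₂, X w.1 w.2 ≠ 0 → β < ∑ r : Fin m × Fin m,
      if ∃ z : Fin p₁ × Fin p₂, X z.1 z.2 ≠ 0 ∧ z ≠ w ∧ A r.1 z.1 * B r.2 z.2 ≠ 0 then 0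
      else A r.1 w.1 * B r.2 w.2)
    (hout : ∀ w : Fin p₁ × Fin p₂, X w.1 w.2 = 0 → (∑ r : Fin m × Fin m,
      if ∃ z : Fin p₁ × Fin p₂, X z.1 z.2 ≠ 0 ∧ z ≠ w ∧ A r.1 z.1 * B r.2 z.2 ≠ 0 then
      A r.1 w.1 * B r.2 w.2 else 0) ≤ β) :
    L1Recovers A B X := by
  refine l1Recovers_of_forall_ker fun V hV hV0 => ?_
  let Ω : Finset (Fin p₁ × Fin p₂) := Finset.univ.filter fun w => X w.1 w.2 ≠ 0
  have hker : ∀ r : Fin m × Fin m, ∑ w : Fin p₁ × Fin p₂,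
      A r.1 w.1 * B r.2 w.2 * V w.1 w.2 = 0 := by
    intro r
    have := congrFun (congrFun hV r.1) r.2
    simp only [Matrix.mul_apply, Matrix.transpose_apply, Matrix.zero_apply, Finset.sum_mul] at this
    rw [← this, Fintype.sum_prod_type_right]
    exact Finset.sum_congr rfl fun _ _ => Finset.sum_congr rfl fun _ _ => by ring
  have hne : (fun w : Fin p₁ × Fin p₂ => V w.1 w.2) ≠ 0 := fun h =>
    hV0 (Matrix.ext fun i j => congrFun h (i, j))
  have hlt := sum_abs_lt_sum_abs_compl (fun (r : Fin m × Fin m) (w : Fin p₁ × Fin p₂) =>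
      A r.1 w.1 * B r.2 w.2) (fun r w => mul_nonneg (hA _ _) (hB _ _)) Ω β
      (fun w => V w.1 w.2) hker (fun w hw => by simpa [Ω] using hin w (by simpa [Ω] using hw))
      (fun w hw => by simpa [Ω] using hout w (by simpa [Ω] using hw)) hβ hne
  have hX : entryL1 X = ∑ w ∈ Ω, |X w.1 w.2| := by
    rw [entryL1, ← Fintype.sum_prod_type', ← Finset.sum_add_sum_compl Ω, add_eq_left]
    refine Finset.sum_eq_zero fun w hw => ?_
    have : X w.1 w.2 = 0 := by simpa [Ω] using hw
    rw [this, abs_zero]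
  have hXV : entryL1 (X + V) = ∑ w ∈ Ω, |X w.1 w.2 + V w.1 w.2| + ∑ w ∈ Ωᶜ, |V w.1 w.2| := by
    rw [entryL1, ← Fintype.sum_prod_type', ← Finset.sum_add_sum_compl Ω]
    congr 1
    refine Finset.sum_congr rfl fun w hw => ?_
    have : X w.1 w.2 = 0 := by simpa [Ω] using hw
    rw [Matrix.add_apply, this, zero_add]
  have htri : ∑ w ∈ Ω, |X w.1 w.2| ≤
      ∑ w ∈ Ω, |X w.1 w.2 + V w.1 w.2| + ∑ w ∈ Ω, |V w.1 w.2| := by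
    rw [← Finset.sum_add_distrib]
    refine Finset.sum_le_sum fun w _ => ?_
    simpa using abs_sub (X w.1 w.2 + V w.1 w.2) (V w.1 w.2)
  rw [hX, hXV]
  linarith

/-! ### Exponential moments: hits of a sparse set and repetitions -/

/-- The generating function of the number of hits of `W` by independent uniform pairs, where the
second coordinates are indexed through a permutation. -/
theorem sum_pow_card_hits {m δ : ℕ} (W : Finset (Fin m × Fin m)) (σ : Equiv.Perm (Fin δ)) (x : ℝ) :
    ∑ u : (Fin δ → Fin m) × (Fin δ → Fin m),
      x ^ (Finset.univ.filter fun k => (u.1 k, u.2 (σ k)) ∈ W).card =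
    ((m : ℝ) ^ 2 + (x - 1) * W.card) ^ δ := by
  have hbase : ∑ a : Fin m × Fin m, (if a ∈ W then x else 1) = (m : ℝ) ^ 2 + (x - 1) * W.card := by
    have : ∀ a : Fin m × Fin m, (if a ∈ W then x else 1) = 1 + if a ∈ W then x - 1 else 0 := by
      intro a
      split_ifs <;> ring
    simp_rw [this, Finset.sum_add_distrib]
    simp
    ring
  -- Pairing the samples along σ is a bijection onto sequences of δ cells, so the sum factors over
  -- the cells.
  rw [← hbase, Finset.sum_pow', Fintype.piFinset_univ]
  refine Fintype.sum_equiv (((Equiv.refl _).prodCongr (Equiv.arrowCongr σ.symm (Equiv.refl _))).trans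
    (Equiv.arrowProdEquivProdArrow _ _ _).symm) _ _ fun u => ?_
  rw [Finset.card_filter, ← Finset.prod_pow_eq_pow_sum]
  refine Finset.prod_congr rfl fun k _ => ?_
  simp only [Equiv.trans_apply, Equiv.prodCongr_apply, Prod.map, Equiv.refl_apply,
    Equiv.arrowProdEquivProdArrow, Equiv.coe_fn_symm_mk, Equiv.arrowCongr_apply,
    Function.comp_apply, Equiv.symm_symm, id, Equiv.coe_refl]
  split_ifs <;> simp

/-- A sparse set of cells is rarely hit by a substantial part of the grid formed by two
independent uniform samples. -/
theorem card_many_hits_mul_pow_le {m δ : ℕ} (hδ : 0 < δ) (W : Finset (Fin m × Fin m)) {y : ℝ}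
    (hy : 1 ≤ y)
    (hW : W.card * y ^ 8 ≤ (m : ℝ) ^ 2) :
    ((Finset.univ.filter fun u : (Fin δ → Fin m) × (Fin δ → Fin m) => δ ^ 2 ≤
      8 * (Finset.univ.filter fun k : Fin δ × Fin δ => (u.1 k.1, u.2 k.2) ∈ W).card).card : ℝ) *
      y ^ δ ≤ δ * (2 * (m : ℝ) ^ 2) ^ δ := by
  have : NeZero δ := ⟨hδ.ne'⟩
  -- The grid splits into the δ cyclic diagonals (k, s + k), each of which uses every coordinate
  -- exactly once.
  have hgrid : ∀ u : (Fin δ → Fin m) × (Fin δ → Fin m),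
      (Finset.univ.filter fun k : Fin δ × Fin δ => (u.1 k.1, u.2 k.2) ∈ W).card =
      ∑ s : Fin δ, (Finset.univ.filter fun k => (u.1 k, u.2 (Equiv.addRight s k)) ∈ W).card := by
    intro u
    simp only [Finset.card_filter]
    rw [Finset.sum_comm, Fintype.sum_prod_type]
    refine Finset.sum_congr rfl fun k _ => ?_
    exact (Fintype.sum_equiv (Equiv.addLeft k) _ _ fun s => rfl).symm
  have hpt : ∀ u ∈ Finset.univ.filter fun u : (Fin δ → Fin m) × (Fin δ → Fin m) => δ ^ 2 ≤
      8 * (Finset.univ.filter fun k : Fin δ × Fin δ => (u.1 k.1, u.2 k.2) ∈ W).card,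
      y ^ δ ≤ ∑ s : Fin δ, (y ^ 8) ^
        (Finset.univ.filter fun k => (u.1 k, u.2 (Equiv.addRight s k)) ∈ W).card := by
    intro u hu
    rw [Finset.mem_filter, hgrid u] at hu
    -- Pigeonhole: with δ²/8 hits in the grid, some diagonal has at least δ/8. The base y⁸ then
    -- contributes at least y^δ.
    obtain ⟨s, hs⟩ : ∃ s : Fin δ,
        δ ≤ 8 * (Finset.univ.filter fun k => (u.1 k, u.2 (Equiv.addRight s k)) ∈ W).card := by
      by_contra! h
      have := Finset.sum_lt_sum_of_nonempty (s := Finset.univ) ⟨0, Finset.mem_univ _⟩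
        fun s _ => h s
      rw [← Finset.mul_sum, Finset.sum_const, Finset.card_univ, Fintype.card_fin, smul_eq_mul,
        ← sq] at this
      exact absurd hu.2 (not_le.mpr this)
    refine le_trans ?_ (Finset.single_le_sum (f := fun s : Fin δ => (y ^ 8) ^
        (Finset.univ.filter fun k => (u.1 k, u.2 (Equiv.addRight s k)) ∈ W).card)
        (fun _ _ => by positivity) (Finset.mem_univ s))
    rw [← pow_mul]
    exact pow_le_pow_right₀ hy hs
  have hsum := Finset.card_nsmul_le_sum _ _ _ hpt
  rw [nsmul_eq_mul] at hsum
  refine hsum.trans (le_trans (Finset.sum_le_univ_sum_of_nonneg fun u =>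
    Finset.sum_nonneg fun s _ => by positivity) ?_)
  rw [Finset.sum_comm]
  simp_rw [sum_pow_card_hits W _ (y ^ 8)]
  rw [Finset.sum_const, Finset.card_univ, Fintype.card_fin, nsmul_eq_mul]
  refine mul_le_mul_of_nonneg_left (pow_le_pow_left₀ ?_ ?_ _) (Nat.cast_nonneg δ)
  · have : (1 : ℝ) ≤ y ^ 8 := one_le_pow₀ hy
    exact add_nonneg (sq_nonneg _) (mul_nonneg (sub_nonneg.mpr this) (Nat.cast_nonneg _))
  · nlinarith [(Nat.cast_nonneg W.card : (0 : ℝ) ≤ W.card)]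

/-- The generating function of the number of repetitions in a uniform sample. -/
theorem sum_pow_sub_card_image_le (m : ℕ) {x : ℝ} (hx : 1 ≤ x) (n : ℕ) :
    ∑ e : Fin n → Fin m, x ^ (n - (Finset.univ.image e).card) ≤ (m + n * x) ^ n := by
  induction n with
  | zero => simp
  | succ n ih =>
    rw [← (Fin.consEquiv fun _ : Fin (n + 1) => Fin m).sum_comp, Fintype.sum_prod_type_right]
    have hstep : ∀ e : Fin n → Fin m,
        ∑ a : Fin m, x ^ (n + 1 - (Finset.univ.image
          ((Fin.consEquiv fun _ : Fin (n + 1) => Fin m) (a, e))).card) ≤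
        x ^ (n - (Finset.univ.image e).card) * (m + (n + 1 : ℕ) * x) := by
      intro e
      have hle : (Finset.univ.image e).card ≤ n := by
        simpa using Finset.card_image_le (s := Finset.univ) (f := e)
      have him : ∀ a : Fin m, Finset.univ.image ((Fin.consEquiv fun _ : Fin (n + 1) => Fin m)
          (a, e)) = insert a (Finset.univ.image e) := by
        intro a
        ext b
        simp [Fin.consEquiv, Fin.exists_fin_succ, eq_comm]
      -- A new draw creates a repetition only when it falls among the at most n values already seen;
      -- that costs one factor x.
      have hterm : ∀ a : Fin m, x ^ (n + 1 - (Finset.univ.image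
          ((Fin.consEquiv fun _ : Fin (n + 1) => Fin m) (a, e))).card) ≤
          x ^ (n - (Finset.univ.image e).card) * (1 + if a ∈ Finset.univ.image e then x else 0) := by
        intro a
        rw [him]
        by_cases h : a ∈ Finset.univ.image e
        · rw [Finset.insert_eq_of_mem h, if_pos h, Nat.sub_add_comm hle, pow_succ]
          exact mul_le_mul_of_nonneg_left (by linarith) (by positivity)
        · rw [Finset.card_insert_of_notMem h, if_neg h, Nat.add_sub_add_right, add_zero, mul_one]
      refine (Finset.sum_le_sum fun a _ => hterm a).trans ?_
      rw [← Finset.mul_sum, Finset.sum_add_distrib]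
      refine mul_le_mul_of_nonneg_left ?_ (by positivity)
      rw [Finset.sum_ite_mem, Finset.univ_inter, Finset.sum_const, Finset.sum_const,
        Finset.card_univ, Fintype.card_fin, nsmul_eq_mul, nsmul_eq_mul, mul_one]
      have : ((Finset.univ.image e).card : ℝ) ≤ (n + 1 : ℕ) := by exact_mod_cast hle.trans n.le_succ
      gcongr
    refine (Finset.sum_le_sum fun e _ => hstep e).trans ?_
    rw [← Finset.sum_mul, pow_succ]
    refine mul_le_mul_of_nonneg_right (ih.trans ?_) (by positivity)
    gcongr
    exact n.le_succ

/-- A uniform sample rarely has many repetitions. -/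
theorem card_small_image_mul_pow_le {m δ : ℕ} {y : ℝ} (hy : 1 ≤ y) (hm : δ * y ^ 2 ≤ (m : ℝ)) :
    ((Finset.univ.filter fun e : Fin δ → Fin m =>
      2 * (Finset.univ.image e).card ≤ δ).card : ℝ) * y ^ δ ≤ (2 * m) ^ δ := by
  have hpt : ∀ e ∈ Finset.univ.filter fun e : Fin δ → Fin m =>
      2 * (Finset.univ.image e).card ≤ δ,
      -- At most δ/2 distinct values means at least δ/2 repetitions.
      y ^ δ ≤ (y ^ 2) ^ (δ - (Finset.univ.image e).card) := by
    intro e he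
    rw [Finset.mem_filter] at he
    rw [← pow_mul]
    exact pow_le_pow_right₀ hy (by omega)
  have hsum := Finset.card_nsmul_le_sum _ _ _ hpt
  rw [nsmul_eq_mul] at hsum
  refine hsum.trans (le_trans (Finset.sum_le_univ_sum_of_nonneg fun u => by positivity) ?_)
  refine (sum_pow_sub_card_image_le m (one_le_pow₀ hy) δ).trans ?_
  gcongr
  linarith

/-! ### Conditioning by resampling -/

/-- Resampling one coordinate does not change an average. -/
theorem sum_sum_update {ι α : Type*} [Fintype ι] [DecidableEq ι] [Fintype α]
    (F : (ι → α) → ℝ) (i : ι) :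
    ∑ e : ι → α, ∑ u : α, F (Function.update e i u) = Fintype.card α * ∑ e, F e := by
  -- Swapping the i-th coordinate with the fresh sample is an involution, so it preserves uniform
  -- counting.
  let T : (ι → α) × α → (ι → α) × α := fun z => (Function.update z.1 i z.2, z.1 i)
  have hT : Function.Involutive T := by
    rintro ⟨e, u⟩
    simp [T]
  rw [← Fintype.sum_prod_type']
  refine (Equiv.sum_comp hT.toPerm fun z => F z.1).trans ?_
  rw [Fintype.sum_prod_type_right]
  simp only [Finset.sum_const, Finset.card_univ, nsmul_eq_mul]

/-- If an event has conditional proportion at most `κ` whenever all but one coordinate on each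
side are fixed, then it has proportion at most `κ`. -/
theorem card_filter_le_of_update {ι ι' α : Type*} [Fintype ι] [DecidableEq ι] [Fintype ι']
    [DecidableEq ι'] [Fintype α] [Nonempty α] (P : (ι → α) × (ι' → α) → Prop) [DecidablePred P]
    (i : ι) (i' : ι') (κ : ℝ)
    (h : ∀ e f, ((Finset.univ.filter fun u : α × α =>
      P (Function.update e i u.1, Function.update f i' u.2)).card : ℝ) ≤
        κ * (Fintype.card α : ℝ) ^ 2) :
    ((Finset.univ.filter P).card : ℝ) ≤
      κ * Fintype.card ((ι → α) × (ι' → α)) := by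
  have hα : (0 : ℝ) < Fintype.card α := by exact_mod_cast Fintype.card_pos
  have hcard : ((Finset.univ.filter P).card : ℝ) = ∑ e : ι → α, ∑ f : ι' → α,
      if P (e, f) then (1 : ℝ) else 0 := by
    rw [← Fintype.sum_prod_type', Finset.sum_boole]
  have key : (Fintype.card α : ℝ) ^ 2 * (Finset.univ.filter P).card =
      ∑ e : ι → α, ∑ f : ι' → α, ((Finset.univ.filter fun u : α × α =>
        P (Function.update e i u.1, Function.update f i' u.2)).card : ℝ) := by
    rw [hcard, sq, mul_assoc, ← sum_sum_update _ i, Finset.mul_sum]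
    refine Finset.sum_congr rfl fun e _ => ?_
    rw [Finset.mul_sum]
    simp_rw [← sum_sum_update _ i']
    rw [Finset.sum_comm]
    refine Finset.sum_congr rfl fun f _ => ?_
    rw [← Fintype.sum_prod_type', Finset.sum_boole]
  have hle := Finset.sum_le_sum fun e (_ : e ∈ Finset.univ) =>
    Finset.sum_le_sum fun f (_ : f ∈ Finset.univ) => h e f
  rw [← key] at hle
  refine le_of_mul_le_mul_left (hle.trans_eq ?_) (pow_pos hα 2)
  simp only [Finset.sum_const, Finset.card_univ, nsmul_eq_mul, Fintype.card_prod, Nat.cast_mul]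
  ring

/-! ### Collisions and the deterministic recovery criterion -/

open Classical in
/-- The number of pairs of edges at `w = (i, i')` whose right end is also a right end of a pair of
edges at another element of `S`. -/
def collisionCount {p₁ p₂ m δ : ℕ} (S : Finset (Fin p₁ × Fin p₂)) (e : LeftRegularGraph p₁ m δ)
    (f : LeftRegularGraph p₂ m δ) (w : Fin p₁ × Fin p₂) : ℕ :=
  (Finset.univ.filter fun k : Fin δ × Fin δ =>
    ∃ z ∈ S, z ≠ w ∧ (∃ l, e z.1 l = e w.1 k.1) ∧ ∃ l, f z.2 l = f w.2 k.2).card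

theorem multAdj_ne_zero_iff {p m δ : ℕ} (e : LeftRegularGraph p m δ) (r : Fin m) (i : Fin p) :
    multAdj e r i ≠ 0 ↔ ∃ k, e i k = r := by
  simp [multAdj, Finset.filter_eq_empty_iff]

theorem zeroOneAdj_ne_zero_iff {p m δ : ℕ} (e : LeftRegularGraph p m δ) (r : Fin m) (i : Fin p) :
    zeroOneAdj e r i ≠ 0 ↔ ∃ k, e i k = r := by
  simp [zeroOneAdj]

theorem zeroOneAdj_nonneg {p m δ : ℕ} (e : LeftRegularGraph p m δ) (r : Fin m) (i : Fin p) :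
    0 ≤ zeroOneAdj e r i := by
  simp only [zeroOneAdj, Matrix.of_apply]
  split_ifs <;> norm_num

theorem multAdj_nonneg {p m δ : ℕ} (e : LeftRegularGraph p m δ) (r : Fin m) (i : Fin p) :
    0 ≤ multAdj e r i :=
  Nat.cast_nonneg _

/-- Lets the 0-1 convention inherit the upper bound on shared weight from the count of colliding
edge pairs. -/
theorem zeroOneAdj_le_multAdj {p m δ : ℕ} (e : LeftRegularGraph p m δ) (r : Fin m) (i : Fin p) :
    zeroOneAdj e r i ≤ multAdj e r i := by
  by_cases h : ∃ k, e i k = r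
  · have h1 : zeroOneAdj e r i = 1 := by simp [zeroOneAdj, h]
    rw [h1]
    have : (Finset.univ.filter fun k => e i k = r).card ≠ 0 := by
      simpa [Finset.filter_eq_empty_iff] using h
    simp only [multAdj, Matrix.of_apply]
    exact_mod_cast Nat.one_le_iff_ne_zero.mpr this
  · have h1 : zeroOneAdj e r i = 0 := by simp [zeroOneAdj, h]
    rw [h1]
    exact multAdj_nonneg e r i

theorem sum_zeroOneAdj {p m δ : ℕ} (e : LeftRegularGraph p m δ) (i : Fin p) :
    ∑ r, zeroOneAdj e r i = (Finset.univ.image (e i)).card := by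
  simp only [zeroOneAdj, Matrix.of_apply, Finset.sum_boole]
  congr 2
  ext r
  simp

/-- Multiplicities make a weighted sum over right vertices a sum over edges, which is how matrix
weights become edge counts. -/
theorem sum_mul_multAdj {p m δ : ℕ} (e : LeftRegularGraph p m δ) (i : Fin p) (φ : Fin m → ℝ) :
    ∑ r, φ r * multAdj e r i = ∑ k, φ (e i k) := by
  simp only [multAdj, Matrix.of_apply, Finset.card_filter, Nat.cast_sum, Finset.mul_sum]
  rw [Finset.sum_comm]
  simp

theorem sum_mul_multAdj_mul_multAdj {p₁ p₂ m δ : ℕ} (e : LeftRegularGraph p₁ m δ)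
    (f : LeftRegularGraph p₂ m δ) (w : Fin p₁ × Fin p₂) (φ : Fin m × Fin m → ℝ) :
    ∑ r : Fin m × Fin m, φ r * (multAdj e r.1 w.1 * multAdj f r.2 w.2) =
      ∑ k : Fin δ × Fin δ, φ (e w.1 k.1, f w.2 k.2) := by
  rw [Fintype.sum_prod_type, Fintype.sum_prod_type,
    ← sum_mul_multAdj e w.1 fun r => ∑ k, φ (r, f w.2 k)]
  refine Finset.sum_congr rfl fun r _ => ?_
  rw [← sum_mul_multAdj f w.2 fun r' => φ (r, r'), Finset.sum_mul]
  exact Finset.sum_congr rfl fun _ _ => by ring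

open Classical in
/-- With few collisions and few repeated edges, both adjacency conventions allow recovery. -/
theorem l1Recovers_of_collisionCount {p₁ p₂ m δ : ℕ} (X : Matrix (Fin p₁) (Fin p₂) ℝ)
    (e : LeftRegularGraph p₁ m δ) (f : LeftRegularGraph p₂ m δ)
    (hcol : ∀ w, 8 * collisionCount (Finset.univ.filter fun z : Fin p₁ × Fin p₂ => X z.1 z.2 ≠ 0)
      e f w < δ ^ 2)
    (he : ∀ i, δ < 2 * (Finset.univ.image (e i)).card)
    (hf : ∀ i, δ < 2 * (Finset.univ.image (f i)).card) :
    L1Recovers (multAdj e) (multAdj f) X ∧ L1Recovers (zeroOneAdj e) (zeroOneAdj f) X := by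
  have hcount : ∀ w : Fin p₁ × Fin p₂, (∑ r : Fin m × Fin m,
      if ∃ z : Fin p₁ × Fin p₂, X z.1 z.2 ≠ 0 ∧ z ≠ w ∧ (∃ k, e z.1 k = r.1) ∧ ∃ k, f z.2 k = r.2
      then multAdj e r.1 w.1 * multAdj f r.2 w.2 else 0) =
      collisionCount (Finset.univ.filter fun z : Fin p₁ × Fin p₂ => X z.1 z.2 ≠ 0) e f w := by
    intro w
    have := sum_mul_multAdj_mul_multAdj e f w fun r => if ∃ z : Fin p₁ × Fin p₂,
      X z.1 z.2 ≠ 0 ∧ z ≠ w ∧ (∃ k, e z.1 k = r.1) ∧ ∃ k, f z.2 k = r.2 then 1 else 0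
    simp only [ite_mul, one_mul, zero_mul] at this
    rw [this, Finset.sum_boole, collisionCount]
    simp
  have hcol' : ∀ w, (collisionCount (Finset.univ.filter fun z : Fin p₁ × Fin p₂ => X z.1 z.2 ≠ 0)
      e f w : ℝ) < (δ : ℝ) ^ 2 / 8 := by
    intro w
    have : (8 * collisionCount (Finset.univ.filter fun z : Fin p₁ × Fin p₂ => X z.1 z.2 ≠ 0)
      e f w : ℝ) < (δ : ℝ) ^ 2 := by exact_mod_cast hcol w
    linarith
  have hsplit : ∀ (c : Fin m × Fin m → Prop) [DecidablePred c] (g : Fin m × Fin m → ℝ),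
      (∑ r, if c r then 0 else g r) = ∑ r, g r - ∑ r, if c r then g r else 0 := by
    intro c _ g
    rw [← Finset.sum_sub_distrib]
    exact Finset.sum_congr rfl fun r _ => by split_ifs <;> ring
  constructor
  · refine l1Recovers_of_weights (multAdj_nonneg e) (multAdj_nonneg f) X ((δ : ℝ) ^ 2 / 8)
      (by positivity) (fun w _ => ?_) fun w _ => ?_
    · simp only [mul_ne_zero_iff, multAdj_ne_zero_iff]
      rw [hsplit, hcount]
      have htot := sum_mul_multAdj_mul_multAdj e f w fun _ => 1
      simp only [one_mul, Finset.sum_const, Finset.card_univ, Fintype.card_prod, Fintype.card_fin,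
        nsmul_eq_mul, mul_one, Nat.cast_mul] at htot
      rw [htot]
      have := hcol' w
      have h0 : (0 : ℝ) ≤ collisionCount (Finset.univ.filter
        fun z : Fin p₁ × Fin p₂ => X z.1 z.2 ≠ 0) e f w := Nat.cast_nonneg _
      nlinarith
    · simp only [mul_ne_zero_iff, multAdj_ne_zero_iff]
      rw [hcount]
      exact (hcol' w).le
  · have hle : ∀ w : Fin p₁ × Fin p₂, (∑ r : Fin m × Fin m,
      if ∃ z : Fin p₁ × Fin p₂, X z.1 z.2 ≠ 0 ∧ z ≠ w ∧ (∃ k, e z.1 k = r.1) ∧ ∃ k, f z.2 k = r.2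
      then zeroOneAdj e r.1 w.1 * zeroOneAdj f r.2 w.2 else 0) ≤ (δ : ℝ) ^ 2 / 8 := by
      intro w
      refine le_trans (Finset.sum_le_sum fun r _ => ?_) ((hcount w).trans_le (hcol' w).le)
      split_ifs
      · exact mul_le_mul (zeroOneAdj_le_multAdj _ _ _) (zeroOneAdj_le_multAdj _ _ _)
          (zeroOneAdj_nonneg _ _ _) (multAdj_nonneg _ _ _)
      · exact le_rfl
    refine l1Recovers_of_weights (zeroOneAdj_nonneg e) (zeroOneAdj_nonneg f) X ((δ : ℝ) ^ 2 / 8)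
      (by positivity) (fun w _ => ?_) fun w _ => ?_
    · simp only [mul_ne_zero_iff, zeroOneAdj_ne_zero_iff]
      rw [hsplit, Fintype.sum_prod_type]
      simp_rw [← Finset.mul_sum, sum_zeroOneAdj, ← Finset.sum_mul, sum_zeroOneAdj]
      -- The total 0-1 weight exceeds (δ/2)² = δ²/4; removing a shared part of at most δ²/8 leaves
      -- more than δ²/8.
      have h1 : (δ : ℝ) < 2 * (Finset.univ.image (e w.1)).card := by exact_mod_cast he w.1
      have h2 : (δ : ℝ) < 2 * (Finset.univ.image (f w.2)).card := by exact_mod_cast hf w.2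
      have h3 : (0 : ℝ) ≤ δ := Nat.cast_nonneg _
      have := hle w
      nlinarith
    · simp only [mul_ne_zero_iff, zeroOneAdj_ne_zero_iff]
      exact hle w

/-- With all other vertices fixed, collisions at `w` are hits of a set of cells of controlled
size. -/
theorem exists_collisionCount_le {p₁ p₂ m δ d : ℕ} (S : Finset (Fin p₁ × Fin p₂))
    (hrow : ∀ i, (S.filter fun z => z.1 = i).card ≤ d)
    (hcol : ∀ i, (S.filter fun z => z.2 = i).card ≤ d)
    (e : LeftRegularGraph p₁ m δ) (f : LeftRegularGraph p₂ m δ) (w : Fin p₁ × Fin p₂) :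
    ∃ W : Finset (Fin m × Fin m), W.card ≤ 2 * (m * (d * δ)) + p₁ * d * (δ * δ) ∧
      ∀ u v : Fin δ → Fin m,
        collisionCount S (Function.update e w.1 u) (Function.update f w.2 v) w ≤
          (Finset.univ.filter fun k : Fin δ × Fin δ => (u k.1, v k.2) ∈ W).card := by
  classical
  have himage : ∀ g : Fin δ → Fin m, (Finset.univ.image g).card ≤ δ := fun g => by
    simpa using Finset.card_image_le (s := Finset.univ) (f := g)
  -- A colliding z may share a coordinate with w, whose ends are being resampled. Only the other
  -- coordinate is then constrained, giving full strips over A₁ or A₂; if z shares neither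
  -- coordinate, the hit cell lies in A₃.
  let A₁ := (S.filter fun z => z.1 = w.1).biUnion fun z => Finset.univ.image (f z.2)
  let A₂ := (S.filter fun z => z.2 = w.2).biUnion fun z => Finset.univ.image (e z.1)
  let A₃ := S.biUnion fun z => Finset.univ.image (e z.1) ×ˢ Finset.univ.image (f z.2)
  have hA₁ : A₁.card ≤ d * δ := (Finset.card_biUnion_le_card_mul _ _ δ fun z _ => himage _).trans
    (Nat.mul_le_mul_right _ (hrow _))
  have hA₂ : A₂.card ≤ d * δ := (Finset.card_biUnion_le_card_mul _ _ δ fun z _ => himage _).trans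
    (Nat.mul_le_mul_right _ (hcol _))
  have hS : S.card ≤ p₁ * d := by
    rw [Finset.card_eq_sum_card_fiberwise (f := Prod.fst) (t := Finset.univ)
      fun _ _ => Finset.mem_coe.mpr (Finset.mem_univ _)]
    refine (Finset.sum_le_sum fun i _ => hrow i).trans ?_
    simp
  have hA₃ : A₃.card ≤ p₁ * d * (δ * δ) :=
    (Finset.card_biUnion_le_card_mul _ _ (δ * δ) fun z _ => by
      rw [Finset.card_product]
      exact Nat.mul_le_mul (himage _) (himage _)).trans (Nat.mul_le_mul_right _ hS)
  refine ⟨Finset.univ ×ˢ A₁ ∪ A₂ ×ˢ Finset.univ ∪ A₃, ?_, fun u v => ?_⟩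
  · refine (Finset.card_union_le _ _).trans (Nat.add_le_add
      ((Finset.card_union_le _ _).trans ?_) hA₃)
    rw [Finset.card_product, Finset.card_product, Finset.card_univ, Fintype.card_fin, two_mul,
      mul_comm A₂.card]
    exact Nat.add_le_add (Nat.mul_le_mul_left _ hA₁) (Nat.mul_le_mul_left _ hA₂)
  · refine Finset.card_le_card fun k hk => ?_
    simp only [Finset.mem_filter, Finset.mem_univ, true_and, Function.update_self] at hk ⊢
    obtain ⟨z, hz, hne, ⟨l, hl⟩, l', hl'⟩ := hk
    simp only [Finset.mem_union, Finset.mem_product, Finset.mem_univ, true_and, and_true, A₁, A₂,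
      A₃, Finset.mem_biUnion, Finset.mem_filter, Finset.mem_image]
    by_cases h1 : z.1 = w.1
    · have h2 : z.2 ≠ w.2 := fun h2 => hne (Prod.ext h1 h2)
      rw [Function.update_of_ne h2] at hl'
      exact Or.inl (Or.inl ⟨z, ⟨hz, h1⟩, l', hl'⟩)
    · rw [Function.update_of_ne h1] at hl
      by_cases h2 : z.2 = w.2
      · exact Or.inl (Or.inr ⟨z, ⟨hz, h2⟩, l, hl⟩)
      · rw [Function.update_of_ne h2] at hl'
        exact Or.inr ⟨z, hz, ⟨l, hl⟩, l', hl'⟩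

/-! ### The random graph law as counting, and the union bound -/

instance isProbabilityMeasure_randomLeftRegular {p m δ : ℕ} [NeZero m] : 
    IsProbabilityMeasure (randomLeftRegular p m δ) := by
  have : IsProbabilityMeasure (uniformOn (Set.univ : Set (Fin m))) :=
    isProbabilityMeasure_uniformOn Set.finite_univ Set.univ_nonempty
  unfold randomLeftRegular
  infer_instance

theorem randomLeftRegular_singleton {p m δ : ℕ} [NeZero m] (e : LeftRegularGraph p m δ) :
    (randomLeftRegular p m δ).real {e} = (Fintype.card (LeftRegularGraph p m δ) : ℝ)⁻¹ := by
  have : IsProbabilityMeasure (uniformOn (Set.univ : Set (Fin m))) :=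
    isProbabilityMeasure_uniformOn Set.finite_univ Set.univ_nonempty
  rw [Measure.real, randomLeftRegular, Measure.pi_singleton]
  simp_rw [Measure.pi_singleton, uniformOn_univ]
  simp

/-- The law of a pair of independent random graphs is the normalized counting measure. -/
theorem randomLeftRegular_prod_real {p₁ p₂ m δ : ℕ} [NeZero m]
    (P : LeftRegularGraph p₁ m δ × LeftRegularGraph p₂ m δ → Prop) [DecidablePred P] :
    ((randomLeftRegular p₁ m δ).prod (randomLeftRegular p₂ m δ)).real {e | P e} =
      (Finset.univ.filter P).card /
        Fintype.card (LeftRegularGraph p₁ m δ × LeftRegularGraph p₂ m δ) := by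
  have hs : {e | P e} = ((Finset.univ.filter P : Finset _) : Set _) := by simp
  rw [hs, ← sum_measureReal_singleton]
  have hsing : ∀ z : LeftRegularGraph p₁ m δ × LeftRegularGraph p₂ m δ,
      ((randomLeftRegular p₁ m δ).prod (randomLeftRegular p₂ m δ)).real {z} =
        (Fintype.card (LeftRegularGraph p₁ m δ × LeftRegularGraph p₂ m δ) : ℝ)⁻¹ := by
    rintro ⟨e, f⟩
    rw [← Set.singleton_prod_singleton, measureReal_prod_prod, randomLeftRegular_singleton,
      randomLeftRegular_singleton, Fintype.card_prod, Nat.cast_mul, mul_inv]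
  simp_rw [hsing]
  rw [Finset.sum_const, nsmul_eq_mul, div_eq_mul_inv]

/-- Graph pairs with many collisions at some vertex pair or many repeated edges at some vertex
are rare. -/
theorem card_collisions_or_repetitions_le {p₁ p₂ m δ d : ℕ} [NeZero m] (hp₁ : 0 < p₁)
    (hp₂ : 0 < p₂) (hδ : 0 < δ) (S : Finset (Fin p₁ × Fin p₂))
    (hrow : ∀ i, (S.filter fun z => z.1 = i).card ≤ d)
    (hcol : ∀ i, (S.filter fun z => z.2 = i).card ≤ d) {y : ℝ} (hy : 1 ≤ y)
    (hW : (2 * (m * (d * δ)) + p₁ * d * (δ * δ)) * y ^ 8 ≤ (m : ℝ) ^ 2)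
    (hm : δ * y ^ 2 ≤ (m : ℝ)) :
    ((Finset.univ.filter fun g : LeftRegularGraph p₁ m δ × LeftRegularGraph p₂ m δ =>
      ¬ ((∀ w, 8 * collisionCount S g.1 g.2 w < δ ^ 2) ∧
        (∀ i, δ < 2 * (Finset.univ.image (g.1 i)).card) ∧
        ∀ i, δ < 2 * (Finset.univ.image (g.2 i)).card)).card : ℝ) ≤
      (p₁ * p₂ + (p₁ + p₂)) * ((4 / y) ^ δ *
        Fintype.card (LeftRegularGraph p₁ m δ × LeftRegularGraph p₂ m δ)) := by
  classical
  have hy0 : 0 < y := by linarith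
  have hcardα : (Fintype.card (Fin δ → Fin m) : ℝ) = (m : ℝ) ^ δ := by simp
  have hc : ∀ w, ((Finset.univ.filter fun g : LeftRegularGraph p₁ m δ × LeftRegularGraph p₂ m δ =>
      δ ^ 2 ≤ 8 * collisionCount S g.1 g.2 w).card : ℝ) ≤ (4 / y) ^ δ *
        Fintype.card (LeftRegularGraph p₁ m δ × LeftRegularGraph p₂ m δ) := by
    intro w
    refine card_filter_le_of_update (fun g : LeftRegularGraph p₁ m δ × LeftRegularGraph p₂ m δ =>
      δ ^ 2 ≤ 8 * collisionCount S g.1 g.2 w) w.1 w.2 _ fun e f => ?_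
    obtain ⟨W, hWcard, hWhit⟩ := exists_collisionCount_le S hrow hcol e f w
    have hW' : W.card * y ^ 8 ≤ (m : ℝ) ^ 2 := by
      refine le_trans (mul_le_mul_of_nonneg_right ?_ (by positivity)) hW
      exact_mod_cast hWcard
    have h1 := card_many_hits_mul_pow_le hδ W hy hW'
    rw [hcardα, div_pow, div_mul_eq_mul_div, le_div_iff₀ (by positivity)]
    refine le_trans (mul_le_mul_of_nonneg_right (Nat.cast_le.mpr (Finset.card_le_card ?_))
      (by positivity)) (h1.trans ?_)
    · intro u hu
      simp only [Finset.mem_filter, Finset.mem_univ, true_and] at hu ⊢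
      exact hu.trans (Nat.mul_le_mul_left 8 (hWhit u.1 u.2))
    -- The number δ of diagonals is absorbed into 2^δ, turning 2/y into 4/y.
    · have h2 : (δ : ℝ) ≤ 2 ^ δ := by exact_mod_cast (Nat.lt_two_pow_self (n := δ)).le
      calc (δ : ℝ) * (2 * (m : ℝ) ^ 2) ^ δ ≤ 2 ^ δ * (2 * (m : ℝ) ^ 2) ^ δ := by gcongr
        _ = 4 ^ δ * ((m : ℝ) ^ δ) ^ 2 := by
          rw [← mul_pow, ← pow_mul, mul_comm δ 2, pow_mul, ← mul_pow]
          ring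
  have hrep : ((Finset.univ.filter fun u : Fin δ → Fin m =>
      2 * (Finset.univ.image u).card ≤ δ).card : ℝ) ≤ (4 / y) ^ δ * (m : ℝ) ^ δ := by
    rw [div_pow, div_mul_eq_mul_div, le_div_iff₀ (by positivity), ← mul_pow]
    refine (card_small_image_mul_pow_le hy hm).trans ?_
    gcongr
    norm_num
  have he : ∀ i, ((Finset.univ.filter fun g : LeftRegularGraph p₁ m δ × LeftRegularGraph p₂ m δ =>
      2 * (Finset.univ.image (g.1 i)).card ≤ δ).card : ℝ) ≤ (4 / y) ^ δ *
        Fintype.card (LeftRegularGraph p₁ m δ × LeftRegularGraph p₂ m δ) := by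
    intro i
    -- The event involves only the first graph; vertex 0 of the second is resampled as a dummy.
    refine card_filter_le_of_update (fun g : LeftRegularGraph p₁ m δ × LeftRegularGraph p₂ m δ =>
      2 * (Finset.univ.image (g.1 i)).card ≤ δ) i ⟨0, hp₂⟩ _ fun e f => ?_
    simp only [Function.update_self]
    rw [← Finset.univ_product_univ, Finset.filter_product_left
      (fun u : Fin δ → Fin m => 2 * (Finset.univ.image u).card ≤ δ), Finset.card_product,
      Finset.card_univ, Nat.cast_mul, hcardα, sq, ← mul_assoc]
    gcongr
  have hf : ∀ i, ((Finset.univ.filter fun g : LeftRegularGraph p₁ m δ × LeftRegularGraph p₂ m δ =>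
      2 * (Finset.univ.image (g.2 i)).card ≤ δ).card : ℝ) ≤ (4 / y) ^ δ *
        Fintype.card (LeftRegularGraph p₁ m δ × LeftRegularGraph p₂ m δ) := by
    intro i
    refine card_filter_le_of_update (fun g : LeftRegularGraph p₁ m δ × LeftRegularGraph p₂ m δ =>
      2 * (Finset.univ.image (g.2 i)).card ≤ δ) ⟨0, hp₁⟩ i _ fun e f => ?_
    simp only [Function.update_self]
    rw [← Finset.univ_product_univ, Finset.filter_product_right
      (fun u : Fin δ → Fin m => 2 * (Finset.univ.image u).card ≤ δ), Finset.card_product,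
      Finset.card_univ, Nat.cast_mul, hcardα, sq, ← mul_assoc, mul_comm]
    gcongr
  have hsub : (Finset.univ.filter fun g : LeftRegularGraph p₁ m δ × LeftRegularGraph p₂ m δ =>
      ¬ ((∀ w, 8 * collisionCount S g.1 g.2 w < δ ^ 2) ∧
        (∀ i, δ < 2 * (Finset.univ.image (g.1 i)).card) ∧
        ∀ i, δ < 2 * (Finset.univ.image (g.2 i)).card)) ⊆
      (Finset.univ.biUnion fun w => Finset.univ.filter fun g => δ ^ 2 ≤
        8 * collisionCount S g.1 g.2 w) ∪
      ((Finset.univ.biUnion fun i => Finset.univ.filter fun g =>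
        2 * (Finset.univ.image (g.1 i)).card ≤ δ) ∪
      Finset.univ.biUnion fun i => Finset.univ.filter fun g =>
        2 * (Finset.univ.image (g.2 i)).card ≤ δ) := by
    intro g hg
    simp only [Finset.mem_filter, Finset.mem_univ, true_and, Finset.mem_union,
      Finset.mem_biUnion] at hg ⊢
    by_contra! h
    exact hg h
  have hunion : ∀ {ι : Type} [Fintype ι]
      (t : ι → Finset (LeftRegularGraph p₁ m δ × LeftRegularGraph p₂ m δ)) (κ : ℝ),
      (∀ i, ((t i).card : ℝ) ≤ κ) →
      ((Finset.univ.biUnion t).card : ℝ) ≤ Fintype.card ι * κ := by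
    intro ι _ t κ ht
    refine (Nat.cast_le.mpr Finset.card_biUnion_le).trans ?_
    rw [Nat.cast_sum]
    refine (Finset.sum_le_sum fun i _ => ht i).trans ?_
    rw [Finset.sum_const, Finset.card_univ, nsmul_eq_mul]
  have h1 := hunion _ _ hc
  have h2 := hunion _ _ he
  have h3 := hunion _ _ hf
  rw [Fintype.card_prod, Fintype.card_fin, Fintype.card_fin, Nat.cast_mul] at h1
  rw [Fintype.card_fin] at h2 h3
  refine (Nat.cast_le.mpr ((Finset.card_le_card hsub).trans ((Finset.card_union_le _ _).trans
    (Nat.add_le_add_left (Finset.card_union_le _ _) _)))).trans ?_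
  rw [Nat.cast_add, Nat.cast_add]
  linarith

/-! ### Degrees, densities and the choice of constants -/

theorem card_filter_fst_le_of_rowDegreeLE {p₁ p₂ d : ℕ} {X : Matrix (Fin p₁) (Fin p₂) ℝ}
    [DecidablePred fun z : Fin p₁ × Fin p₂ => X z.1 z.2 ≠ 0]
    (h : RowDegreeLE X d) (i : Fin p₁) :
    ((Finset.univ.filter fun z : Fin p₁ × Fin p₂ => X z.1 z.2 ≠ 0).filter
      fun z => z.1 = i).card ≤ d := by
  classical
  refine le_trans ?_ (h i)
  rw [Set.ncard_eq_toFinset_card']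
  refine Finset.card_le_card_of_injOn Prod.snd (fun z hz => ?_) fun z hz z' hz' heq => ?_
  · simp only [Finset.coe_filter, Finset.mem_filter, Finset.mem_univ, true_and,
      Set.mem_ofPred_eq] at hz
    simpa [← hz.2] using hz.1
  · simp only [Finset.coe_filter, Finset.mem_filter, Finset.mem_univ, true_and,
      Set.mem_ofPred_eq] at hz hz'
    exact Prod.ext (hz.2.trans hz'.2.symm) heq

theorem card_filter_snd_le_of_colDegreeLE {p₁ p₂ d : ℕ} {X : Matrix (Fin p₁) (Fin p₂) ℝ}
    [DecidablePred fun z : Fin p₁ × Fin p₂ => X z.1 z.2 ≠ 0]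
    (h : ColDegreeLE X d) (i : Fin p₂) :
    ((Finset.univ.filter fun z : Fin p₁ × Fin p₂ => X z.1 z.2 ≠ 0).filter
      fun z => z.2 = i).card ≤ d := by
  classical
  refine le_trans ?_ (h i)
  rw [Set.ncard_eq_toFinset_card']
  refine Finset.card_le_card_of_injOn Prod.fst (fun z hz => ?_) fun z hz z' hz' heq => ?_
  · simp only [Finset.coe_filter, Finset.mem_filter, Finset.mem_univ, true_and,
      Set.mem_ofPred_eq] at hz
    simpa [← hz.2] using hz.1
  · simp only [Finset.coe_filter, Finset.mem_filter, Finset.mem_univ, true_and,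
      Set.mem_ofPred_eq] at hz hz'
    exact Prod.ext heq (hz.2.trans hz'.2.symm)

/-- The sampling condition forces the cell density and the repetition density to be small. -/
theorem density_bounds {b K L m δ y d p p₁ : ℝ} (hb : 0 < b) (hy : 1 ≤ y) (hK : K = 4 * y ^ 8)
    (hL : 0 ≤ L) (hδ0 : 0 ≤ δ) (hδ : δ ≤ b * L) (hd : 1 ≤ d) (hp : 1 ≤ p) (hp₁ : 0 ≤ p₁)
    (hp₁p : p₁ ≤ p) (hm : b * K * (Real.sqrt (d * p) * L) ≤ m) :
    (2 * (m * (min d p * δ)) + p₁ * min d p * (δ * δ)) * y ^ 8 ≤ m ^ 2 ∧ δ * y ^ 2 ≤ m := by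
  have hy8 : (1 : ℝ) ≤ y ^ 8 := one_le_pow₀ hy
  have hK0 : 0 < K := by rw [hK]; positivity
  have hs0 : 0 ≤ Real.sqrt (d * p) := Real.sqrt_nonneg _
  have hssq : Real.sqrt (d * p) ^ 2 = d * p := Real.sq_sqrt (by positivity)
  have hD1 : 1 ≤ min d p := le_min hd hp
  -- Here the truncation at p matters: d is only an upper bound for the degrees, and for d > p it
  -- would exceed √(dp).
  have hDs : min d p ≤ Real.sqrt (d * p) := by
    refine Real.le_sqrt_of_sq_le ?_
    rw [sq]
    exact mul_le_mul (min_le_left _ _) (min_le_right _ _) (by linarith) (by linarith)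
  have hm0 : 0 ≤ m := le_trans (by positivity) hm
  have hsδ : K * (Real.sqrt (d * p) * δ) ≤ m := by
    refine le_trans ?_ hm
    calc K * (Real.sqrt (d * p) * δ) ≤ K * (Real.sqrt (d * p) * (b * L)) := by gcongr
      _ = b * K * (Real.sqrt (d * p) * L) := by ring
  have hDδ : K * (min d p * δ) ≤ m := le_trans (by gcongr) hsδ
  have hsq : K ^ 2 * (p₁ * min d p * (δ * δ)) ≤ m ^ 2 := by
    refine le_trans ?_ (pow_le_pow_left₀ (by positivity) hsδ 2)
    rw [mul_pow, mul_pow, hssq]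
    have : p₁ * min d p ≤ d * p := by
      rw [mul_comm]
      exact mul_le_mul (min_le_left _ _) hp₁p hp₁ (by linarith)
    rw [sq δ]
    gcongr
  have hK1 : 1 ≤ K := by rw [hK]; linarith
  have hsq' : K * (p₁ * min d p * (δ * δ)) ≤ m ^ 2 := by
    refine le_trans ?_ hsq
    rw [sq K]
    exact mul_le_mul_of_nonneg_right (by nlinarith) (by positivity)
  constructor
  · have h2 : K * (m * (min d p * δ)) ≤ m ^ 2 := by nlinarith
    have : y ^ 8 = K / 4 := by rw [hK]; ring
    rw [this]
    nlinarith [sq_nonneg m]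
  · refine le_trans ?_ hDδ
    have h28 : y ^ 2 ≤ y ^ 8 := pow_le_pow_right₀ hy (by norm_num)
    have hyK : y ^ 2 ≤ K := by rw [hK]; linarith
    calc δ * y ^ 2 ≤ δ * K := by gcongr
      _ = K * (1 * δ) := by ring
      _ ≤ K * (min d p * δ) := by gcongr

/-- The factor 4 in y cancels the counting loss 4^δ, leaving exp(-5δ/a), and δ ≥ a log p makes this
at most p⁻⁵. -/
theorem pow_le_inv_pow_five {a p : ℝ} {δ : ℕ} (ha : 0 < a) (hp : 0 < p)
    (hδ : a * Real.log p ≤ δ) : (4 / (4 * Real.exp (5 / a))) ^ δ ≤ (p ^ 5)⁻¹ := by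
  have h4 : 4 / (4 * Real.exp (5 / a)) = Real.exp (-(5 / a)) := by
    rw [Real.exp_neg, mul_comm, div_mul_cancel_right₀ (by norm_num)]
  rw [h4, ← Real.exp_nat_mul]
  have : (p ^ 5)⁻¹ = Real.exp (-(5 * Real.log p)) := by
    have h5 := Real.exp_nat_mul (Real.log p) 5
    rw [Real.exp_log hp] at h5
    rw [Real.exp_neg, ← h5]
    norm_num
  rw [this, Real.exp_le_exp]
  have : 5 * Real.log p = 5 / a * (a * Real.log p) := by field_simp
  rw [this]
  nlinarith [mul_le_mul_of_nonneg_left hδ (by positivity : (0 : ℝ) ≤ 5 / a)]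

theorem mainTheorem7 (a b : ℝ) (ha : 0 < a) (hab : a ≤ b) :
    ∃ C c : ℝ, 0 < C ∧ 0 < c ∧
      ∀ (p₁ p₂ p m δ d_r d_c d : ℕ), 0 < p₁ → 0 < p₂ → 0 < m →
        p = max p₁ p₂ → 2 ≤ p → d = max d_r d_c →
        a * Real.log p ≤ δ → δ ≤ b * Real.log p →
        C * (Real.sqrt ((d : ℝ) * p) * Real.log p) ≤ m →
        ∀ X : Matrix (Fin p₁) (Fin p₂) ℝ, RowDegreeLE X d_r → ColDegreeLE X d_c →
          1 - (p : ℝ) ^ (-c) <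
              ((randomLeftRegular p₁ m δ).prod (randomLeftRegular p₂ m δ)).real
                {e | L1Recovers (multAdj e.1) (multAdj e.2) X} ∧
          1 - (p : ℝ) ^ (-c) <
              ((randomLeftRegular p₁ m δ).prod (randomLeftRegular p₂ m δ)).real
                {e | L1Recovers (zeroOneAdj e.1) (zeroOneAdj e.2) X} := by
  have hb : 0 < b := ha.trans_le hab
  have hy : (1 : ℝ) ≤ 4 * Real.exp (5 / a) := by
    have := Real.one_le_exp (by positivity : (0 : ℝ) ≤ 5 / a)
    linarith
  -- C is b K with K = 4y⁸ and y = 4 exp(5/a), the form required by `density_bounds`.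
  refine ⟨b * (4 * (4 * Real.exp (5 / a)) ^ 8), 1, by positivity, one_pos, ?_⟩
  intro p₁ p₂ p m δ d_r d_c d hp₁ hp₂ hm hp hp2 hd hδa hδb hmC X hrow hcol
  classical
  have : NeZero m := ⟨hm.ne'⟩
  have hp2' : (2 : ℝ) ≤ p := by exact_mod_cast hp2
  have hppos : (0 : ℝ) < p := by linarith
  rw [Real.rpow_neg_one]
  have hinv : 0 < (p : ℝ)⁻¹ := by positivity
  rcases Nat.eq_zero_or_pos d with hd0 | hd1
  · have hX : X = 0 := by
      ext i j
      by_contra hne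
      have hr := hrow i
      rw [show d_r = 0 by omega, Nat.le_zero, Set.ncard_eq_zero (Set.toFinite _)] at hr
      exact Set.eq_empty_iff_forall_notMem.mp hr j hne
    subst hX
    simp only [l1Recovers_zero]
    have huniv : {_e : LeftRegularGraph p₁ m δ × LeftRegularGraph p₂ m δ | True} = Set.univ :=
      Set.ofPred_true
    rw [huniv, probReal_univ]
    constructor <;> linarith
  have hlog : 0 < Real.log p := Real.log_pos (by linarith)
  have hδ : 0 < δ := by
    have : (0 : ℝ) < δ := (mul_pos ha hlog).trans_le hδa
    exact_mod_cast this
  have hp₁p : p₁ ≤ p := hp ▸ le_max_left _ _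
  have hp₂p : p₂ ≤ p := hp ▸ le_max_right _ _
  obtain ⟨hW, hrep⟩ := density_bounds (d := d) (p := p) (p₁ := p₁) hb hy rfl hlog.le
    (Nat.cast_nonneg δ) hδb (by exact_mod_cast hd1) (by linarith) (Nat.cast_nonneg _)
    (by exact_mod_cast hp₁p) hmC
  -- Rows and columns have at most p entries, so the degree bound may be truncated at p.
  have hrow' : RowDegreeLE X (min d p) := fun i =>
    le_min ((hrow i).trans (hd ▸ le_max_left _ _))
      ((Set.ncard_le_card _).trans (by simpa using hp₂p))
  have hcol' : ColDegreeLE X (min d p) := fun j =>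
    le_min ((hcol j).trans (hd ▸ le_max_right _ _))
      ((Set.ncard_le_card _).trans (by simpa using hp₁p))
  rw [← Nat.cast_min] at hW
  have hbad := card_collisions_or_repetitions_le hp₁ hp₂ hδ _
    (card_filter_fst_le_of_rowDegreeLE hrow') (card_filter_snd_le_of_colDegreeLE hcol')
    hy hW hrep
  set good : LeftRegularGraph p₁ m δ × LeftRegularGraph p₂ m δ → Prop := fun g =>
    (∀ w, 8 * collisionCount (Finset.univ.filter fun z : Fin p₁ × Fin p₂ => X z.1 z.2 ≠ 0)
      g.1 g.2 w < δ ^ 2) ∧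
      (∀ i, δ < 2 * (Finset.univ.image (g.1 i)).card) ∧
      ∀ i, δ < 2 * (Finset.univ.image (g.2 i)).card
  have hN : (0 : ℝ) < Fintype.card (LeftRegularGraph p₁ m δ × LeftRegularGraph p₂ m δ) := by
    have : Nonempty (Fin m) := ⟨0⟩
    exact_mod_cast Fintype.card_pos
  have hcompl : ((Finset.univ.filter good).card : ℝ) +
      (Finset.univ.filter fun g => ¬ good g).card =
      Fintype.card (LeftRegularGraph p₁ m δ × LeftRegularGraph p₂ m δ) := by
    exact_mod_cast Finset.card_filter_add_card_filter_not (s := Finset.univ) good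
  have hκ := pow_le_inv_pow_five ha hppos hδa
  have hsmall : ((p₁ : ℝ) * p₂ + (p₁ + p₂)) * (4 / (4 * Real.exp (5 / a))) ^ δ < (p : ℝ)⁻¹ := by
    have h1 : (p₁ : ℝ) ≤ p := by exact_mod_cast hp₁p
    have h2 : (p₂ : ℝ) ≤ p := by exact_mod_cast hp₂p
    have h3 : (p₁ : ℝ) * p₂ + (p₁ + p₂) ≤ p * p + (p + p) := by gcongr
    calc ((p₁ : ℝ) * p₂ + (p₁ + p₂)) * (4 / (4 * Real.exp (5 / a))) ^ δ
        ≤ (p * p + (p + p)) * ((p : ℝ) ^ 5)⁻¹ := by gcongr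
      _ < (p : ℝ) ^ 4 * ((p : ℝ) ^ 5)⁻¹ := by
        refine mul_lt_mul_of_pos_right ?_ (by positivity)
        -- For p ≥ 2, p² + 2p ≤ 2p² < 4p² ≤ p⁴.
        have : (4 : ℝ) ≤ p ^ 2 := by nlinarith
        nlinarith
      _ = (p : ℝ)⁻¹ := by field_simp
  have hprob : 1 - (p : ℝ)⁻¹ <
      ((randomLeftRegular p₁ m δ).prod (randomLeftRegular p₂ m δ)).real {g | good g} := by
    rw [randomLeftRegular_prod_real, lt_div_iff₀ hN]
    have h1 := mul_lt_mul_of_pos_right hsmall hN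
    rw [mul_assoc] at h1
    linarith
  exact ⟨hprob.trans_le (measureReal_mono fun g hg =>
      (l1Recovers_of_collisionCount X g.1 g.2 hg.1 hg.2.1 hg.2.2).1),
    hprob.trans_le (measureReal_mono fun g hg =>
      (l1Recovers_of_collisionCount X g.1 g.2 hg.1 hg.2.1 hg.2.2).2)⟩
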